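/- Let $V$ be a finite set and let $P$ be a regular Gaussian distribution on $\mathbb{R}^V$, i.e. the joint distribution of real random variables $(X_v)_{v\in V}$ that is multivariate normal with positive definite covariance matrix. Let $\mathcal{J}(P)$ be the set of triples $\langle A,B\,|\,C\rangle$ of pairwise disjoint subsets of $V$ such that $X_A=(X_v)_{v\in A}$ is conditionally independent of $X_B$ given $X_C$ under $P$. A mixed graph is a loopless graph whose edges are lines ($i - j$), arrows ($i\to j$) or arcs ($i\leftrightarrow j$). It is undirected if all its edges are lines, and bidirected if all its edges are arcs. A section of a walk is a maximal subwalk consisting only of lines (possibly a single node). It is a collider section if it is entered and left by the walk through edges that have an arrowhead at the section. A walk is connecting given $C$ if every collider section on it contains a node of $C$ and every other section is disjoint from $C$. For a graph $G$ with node set $V$, let $\mathcal{J}(G)$ be the set of triples $\langle A,B\,|\,C\rangle$ of pairwise disjoint subsets of $V$ such that there is no connecting walk given $C$ between a node of $A$ and a node of $B$. The distribution $P$ is faithful to $G$ if $\mathcal{J}(P)=\mathcal{J}(G)$. Then: 1. $P$ is faithful to some undirected graph with node set $V$ if and only if $\mathcal{J}(P)$ satisfies upward-stability: whenever $\langle \{i\},\{j\}\,|\,C\rangle\in\mathcal{J}(P)$,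 then $\langle \{i\},\{j\}\,|\,C\cup\{k\}\rangle\in\mathcal{J}(P)$ for every $k\in V\setminus\{i,j\}$. 2. $P$ is faithful to some bidirected graph with node set $V$ if and only if $\mathcal{J}(P)$ satisfies downward-stability: whenever $\langle \{i\},\{j\}\,|\,C\rangle\in\mathcal{J}(P)$, then $\langle \{i\},\{j\}\,|\,C\setminus\{k\}\rangle\in\mathcal{J}(P)$ for every $k\in V\setminus\{i,j\}$. -/

import Mathlib

open MeasureTheory ProbabilityTheory

/-- An independence model over a finite set `V`: a collection of triples `⟨A, B | C⟩` of pairwise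
disjoint subsets of `V` which contains all the triples `⟨∅, B | C⟩` and `⟨A, ∅ | C⟩`. -/
@[ext]
structure IndependenceModel (V : Type*) where
  /-- `J.Indep A B C` means `⟨A, B | C⟩ ∈ J`. -/
  Indep : Finset V → Finset V → Finset V → Prop
  disjoint : ∀ {A B C}, Indep A B C → Disjoint A B ∧ Disjoint A C ∧ Disjoint B C
  empty_left : ∀ {B C}, Disjoint B C → Indep ∅ B C
  empty_right : ∀ {A C}, Disjoint A C → Indep A ∅ C

namespace IndependenceModel

variable {V : Type*} [DecidableEq V]

/-- Upward-stability. -/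
def UpwardStable (J : IndependenceModel V) : Prop :=
  ∀ (i j : V) (C : Finset V), J.Indep {i} {j} C →
    ∀ k : V, k ≠ i → k ≠ j → J.Indep {i} {j} (C ∪ {k})

/-- Downward-stability. -/
def DownwardStable (J : IndependenceModel V) : Prop :=
  ∀ (i j : V) (C : Finset V), J.Indep {i} {j} C →
    ∀ k : V, k ≠ i → k ≠ j → J.Indep {i} {j} (C \ {k})

end IndependenceModel

/-- A loopless mixed graph with node set `V`, with lines `i — j`, arrows `i → j` and
arcs `i ↔ j`; edges of different types between the same two nodes are allowed. -/
structure MixedGraph (V : Type*) where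
  Line : V → V → Prop
  Arrow : V → V → Prop
  Arc : V → V → Prop
  line_symm : ∀ {i j}, Line i j → Line j i
  arc_symm : ∀ {i j}, Arc i j → Arc j i
  line_irrefl : ∀ i, ¬ Line i i
  arrow_irrefl : ∀ i, ¬ Arrow i i
  arc_irrefl : ∀ i, ¬ Arc i i

/-- The four ways in which a walk can traverse an edge from a node `u` to a node `v`:
`u — v`, `u → v`, `u ← v`, `u ↔ v`. -/
inductive Step
  | line
  | forward
  | backward
  | arc

namespace Step

/-- The traversed edge has an arrowhead at the node at which the step ends. -/
def HeadAtEnd : Step → Prop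
  | line => False
  | forward => True
  | backward => False
  | arc => True

/-- The traversed edge has an arrowhead at the node at which the step starts. -/
def HeadAtStart : Step → Prop
  | line => False
  | forward => False
  | backward => True
  | arc => True

end Step

namespace MixedGraph

variable {V : Type*}

/-- `G.HasStep s u v`: the graph has an edge that is traversed from `u` to `v` as `s` says. -/
def HasStep (G : MixedGraph V) : Step → V → V → Prop
  | .line, u, v => G.Line u v
  | .forward, u, v => G.Arrow u v
  | .backward, u, v => G.Arrow v u
  | .arc, u, v => G.Arc u v

/-- An undirected graph: all edges are lines. -/
def IsUndirected (G : MixedGraph V) : Prop :=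
  ∀ i j, ¬ G.Arrow i j ∧ ¬ G.Arc i j

/-- A bidirected graph: all edges are arcs. -/
def IsBidirected (G : MixedGraph V) : Prop :=
  ∀ i j, ¬ G.Line i j ∧ ¬ G.Arrow i j

/-- A walk `node 0, step 0, node 1, …, step (length - 1), node length`. The values of `node` beyond
`length` and of `step` from `length` on are irrelevant. -/
structure Walk (G : MixedGraph V) where
  length : ℕ
  node : ℕ → V
  step : ℕ → Step
  valid : ∀ k < length, G.HasStep (step k) (node k) (node (k + 1))

namespace Walk

variable {G : MixedGraph V}

/-- The subwalk from position `a` to position `b` is a section: a maximal subwalk consisting only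
of lines (possibly of a single node). -/
def IsSection (w : G.Walk) (a b : ℕ) : Prop :=
  a ≤ b ∧ b ≤ w.length ∧
  (∀ k, a ≤ k → k < b → w.step k = .line) ∧
  (∀ k, k + 1 = a → w.step k ≠ .line) ∧
  (b < w.length → w.step b ≠ .line)

/-- A section is a collider section if the walk enters and leaves it through edges with
arrowheads at the section. -/
def IsColliderSection (w : G.Walk) (a b : ℕ) : Prop :=
  w.IsSection a b ∧
  (∃ k, k + 1 = a ∧ (w.step k).HeadAtEnd) ∧
  (b < w.length ∧ (w.step b).HeadAtStart)

/-- A walk is connecting given `C` if every collider section has a node in `C` and every other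
section is disjoint from `C`. -/
def IsConnecting (w : G.Walk) (C : Finset V) : Prop :=
  ∀ a b, w.IsSection a b →
    (w.IsColliderSection a b → ∃ k, a ≤ k ∧ k ≤ b ∧ w.node k ∈ C) ∧
    (¬ w.IsColliderSection a b → ∀ k, a ≤ k → k ≤ b → w.node k ∉ C)

end Walk

/-- `A` and `B` are separated given `C`: there is no connecting walk between them given `C`. -/
def Separated (G : MixedGraph V) (A B C : Finset V) : Prop :=
  ¬ ∃ w : G.Walk, w.node 0 ∈ A ∧ w.node w.length ∈ B ∧ w.IsConnecting C

/-- The independence model `J(G)` induced by a graph. -/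
def indepModel (G : MixedGraph V) : IndependenceModel V where
  Indep A B C := (Disjoint A B ∧ Disjoint A C ∧ Disjoint B C) ∧ G.Separated A B C
  disjoint h := h.1
  empty_left h := ⟨by simp [h], by simp [Separated]⟩
  empty_right h := ⟨by simp [h], by simp [Separated]⟩

end MixedGraph

section Probability

variable {V : Type*}

/-- The subvector `X_A` of the vector of coordinates. -/
def subvector (A : Finset V) (x : EuclideanSpace ℝ V) : A → ℝ := fun i => x i

theorem measurable_subvector (A : Finset V) : Measurable (subvector A) := by
  unfold subvector
  fun_prop

/-- `X_A` is conditionally independent of `X_B` given `X_C` with respect to `P`. -/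
def CondIndepSubvectors [Fintype V] (P : Measure (EuclideanSpace ℝ V)) [IsProbabilityMeasure P]
    (A B C : Finset V) : Prop :=
  CondIndepFun (MeasurableSpace.comap (subvector C) inferInstance)
    (measurable_subvector C).comap_le (subvector A) (subvector B) P

/-- The independence model `J(P)` induced by the joint distribution `P` of real random variables
indexed by `V`. -/
def probIndepModel [Fintype V] (P : Measure (EuclideanSpace ℝ V)) [IsProbabilityMeasure P] :
    IndependenceModel V where
  Indep A B C := (Disjoint A B ∧ Disjoint A C ∧ Disjoint B C) ∧ CondIndepSubvectors P A B C
  disjoint h := h.1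
  empty_left {B C} h := by
    refine ⟨by simp [h], ?_⟩
    have e : subvector (∅ : Finset V) = fun _ => (fun i => 0) := by
      funext x i; exact absurd i.2 (Finset.notMem_empty _)
    rw [CondIndepSubvectors, e]
    exact condIndepFun_const_left _ _
  empty_right {A C} h := by
    refine ⟨by simp [h], ?_⟩
    have e : subvector (∅ : Finset V) = fun _ => (fun i => 0) := by
      funext x i; exact absurd i.2 (Finset.notMem_empty _)
    rw [CondIndepSubvectors, e]
    exact condIndepFun_const_right _ _

/-- `P` and `G` are faithful: `J(P) = J(G)`. -/
def FaithfulTo [Fintype V] (P : Measure (EuclideanSpace ℝ V)) [IsProbabilityMeasure P] (G : MixedGraph V) :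
    Prop :=
  probIndepModel P = G.indepModel

/-- A regular Gaussian distribution: a multivariate normal distribution with positive definite
covariance matrix. -/
def IsRegularGaussian [Fintype V] [DecidableEq V] (P : Measure (EuclideanSpace ℝ V)) : Prop :=
  ∃ (m : EuclideanSpace ℝ V) (S : Matrix V V ℝ), S.PosDef ∧ P = multivariateGaussian m S

end Probability

/-! Write `q` for the bilinear form of the covariance matrix and `R v` for the `q`-residual of the
unit vector at `v` after projection onto the coordinates in `C`. The residuals are independent of
`X_C` and, modulo `X_C`, carry the same information as the coordinates, so `X_A` and `X_B` are
conditionally independent given `X_C` exactly when all partial covariances `q (R i) (R j)` vanish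
(`condIndepSubvectors_multivariateGaussian_iff`). Everything thus reduces to pairs, on the
probabilistic and the graphical side alike.

Adding `k` to `C` changes the partial covariance of `i` and `j` by the rank-one correction `-q (R i)
(R k) * q (R k) (R j) / q (R k) (R k)`. This yields the rules of `IsGaussianPairwise`; from there on
the argument is combinatorial.

For upward-stability, join `i` and `j` when they are dependent given all other nodes. Separation
implies independence by the intersection property; conversely, weak transitivity along a walk
avoiding `C` excludes independence (`iff_notLinkedIn_compl`). For downward-stability, join `i` and
`j` when they are marginally dependent; the dual argument adds nodes to `C` by `insert_of` and
applies weak transitivity along a path with interior in `C` (`iff_notLinkedIn_union`). That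
faithfulness implies stability is monotonicity of graph separation. -/

/-! ### Conditional independence of σ-algebras. -/

section ConditionalIndependence

variable {Ω : Type*} {m m₁ m₂ : MeasurableSpace Ω} {mΩ : MeasurableSpace Ω}

theorem isPiSystem_inter_measurableSet (m₁ m : MeasurableSpace Ω) :
    IsPiSystem {u | ∃ s r, MeasurableSet[m₁] s ∧ MeasurableSet[m] r ∧ u = s ∩ r} := by
  rintro _ ⟨s, r, hs, hr, rfl⟩ _ ⟨s', r', hs', hr', rfl⟩ -
  exact ⟨s ∩ s', r ∩ r', hs.inter hs', hr.inter hr', Set.inter_inter_inter_comm _ _ _ _⟩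

theorem generateFrom_inter_measurableSet (m₁ m : MeasurableSpace Ω) :
    m₁ ⊔ m = MeasurableSpace.generateFrom
      {u | ∃ s r, MeasurableSet[m₁] s ∧ MeasurableSet[m] r ∧ u = s ∩ r} := by
  apply le_antisymm
  · refine sup_le (fun s hs => ?_) (fun r hr => ?_)
    · exact MeasurableSpace.measurableSet_generateFrom
        ⟨s, Set.univ, hs, MeasurableSet.univ, (Set.inter_univ s).symm⟩
    · exact MeasurableSpace.measurableSet_generateFrom
        ⟨Set.univ, r, MeasurableSet.univ, hr, (Set.univ_inter r).symm⟩
  · refine MeasurableSpace.generateFrom_le ?_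
    rintro _ ⟨s, r, hs, hr, rfl⟩
    exact MeasurableSet.inter (le_sup_left (a := m₁) (b := m) s hs)
      (le_sup_right (a := m₁) (b := m) r hr)

variable {μ : Measure Ω} [IsProbabilityMeasure μ]

theorem condExp_indicator_inter {s r : Set Ω} (hs : MeasurableSet s)
    (hr : MeasurableSet[m] r) : μ⟦s ∩ r | m⟧ =ᵐ[μ] r.indicator (μ⟦s | m⟧) := by
  rw [Set.inter_comm, ← Set.indicator_indicator]
  exact condExp_indicator ((integrable_const (1 : ℝ)).indicator hs) hr

variable [StandardBorelSpace Ω]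

/-- Conditionally independent σ-algebras remain so when the conditioning σ-algebra is joined to
both of them. -/
theorem ProbabilityTheory.CondIndep.sup_conditioning (hm : m ≤ mΩ) (h₁ : m₁ ≤ mΩ) (h₂ : m₂ ≤ mΩ)
    (h : CondIndep m m₁ m₂ hm μ) : CondIndep m (m₁ ⊔ m) (m₂ ⊔ m) hm μ := by
  refine CondIndepSets.condIndep (sup_le h₁ hm) (sup_le h₂ hm)
    (isPiSystem_inter_measurableSet m₁ m) (isPiSystem_inter_measurableSet m₂ m)
    (generateFrom_inter_measurableSet m₁ m) (generateFrom_inter_measurableSet m₂ m) ?_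
  rw [condIndepSets_iff]
  · rintro _ _ ⟨s, r, hs, hr, rfl⟩ ⟨t, q, ht, hq, rfl⟩
    rw [Set.inter_inter_inter_comm]
    filter_upwards [condExp_indicator_inter (μ := μ) ((h₁ s hs).inter (h₂ t ht)) (hr.inter hq),
      condExp_indicator_inter (μ := μ) (h₁ s hs) hr,
      condExp_indicator_inter (μ := μ) (h₂ t ht) hq,
      (condIndep_iff m m₁ m₂ hm h₁ h₂ μ).1 h s t hs ht] with ω e e₁ e₂ e₃
    rw [e, Pi.mul_apply, e₁, e₂]
    by_cases hωr : ω ∈ r <;> by_cases hωq : ω ∈ q <;> simp [hωr, hωq, e₃]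
  · rintro _ ⟨s, r, hs, hr, rfl⟩
    exact (h₁ s hs).inter (hm r hr)
  · rintro _ ⟨s, r, hs, hr, rfl⟩
    exact (h₂ s hs).inter (hm r hr)

/-- If `m₁` and `m₂` are jointly independent of `m`, then conditional independence given `m` is
independence. -/
theorem condIndep_iff_indep_of_indep_sup (hm : m ≤ mΩ) (h₁ : m₁ ≤ mΩ) (h₂ : m₂ ≤ mΩ)
    (h : Indep (m₁ ⊔ m₂) m μ) : CondIndep m m₁ m₂ hm μ ↔ Indep m₁ m₂ μ := by
  have key : ∀ s, MeasurableSet[m₁ ⊔ m₂] s → μ⟦s | m⟧ =ᵐ[μ] fun _ => μ.real s := by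
    intro s hs
    have hs' := sup_le h₁ h₂ s hs
    refine (condExp_indep_eq (sup_le h₁ h₂) hm
      (stronglyMeasurable_const.indicator hs) h).trans ?_
    filter_upwards with ω
    rw [integral_indicator hs']
    simp
  rw [condIndep_iff m m₁ m₂ hm h₁ h₂, Indep_iff]
  refine forall_congr' fun s => forall_congr' fun t => forall_congr' fun hs =>
    forall_congr' fun ht => ?_
  have hs' : MeasurableSet[m₁ ⊔ m₂] s := le_sup_left (a := m₁) s hs
  have ht' : MeasurableSet[m₁ ⊔ m₂] t := le_sup_right (a := m₁) (b := m₂) t ht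
  have e : μ (s ∩ t) = μ s * μ t ↔ μ.real (s ∩ t) = μ.real s * μ.real t := by
    rw [measureReal_def, measureReal_def, measureReal_def, ← ENNReal.toReal_mul,
      ENNReal.toReal_eq_toReal_iff' (by finiteness) (by finiteness)]
  rw [e]
  constructor
  · intro H
    -- Both sides are almost surely constant, so one point of the full-measure set suffices.
    obtain ⟨ω, a, a₁, a₂, a₃⟩ :=
      (H.and ((key _ (hs'.inter ht')).and ((key s hs').and (key t ht')))).exists
    rw [Pi.mul_apply, a₁, a₂, a₃] at a
    exact a
  · intro H
    filter_upwards [key _ (hs'.inter ht'), key s hs', key t ht'] with ω a₁ a₂ a₃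
    rw [Pi.mul_apply, a₁, a₂, a₃, H]

end ConditionalIndependence

/-! ### Residuals with respect to a positive definite form. -/

section Residual

variable {V : Type*} [DecidableEq V]

/-- The vectors `R v` are the residuals of the unit vectors after projecting them orthogonally,
with respect to `q`, onto the coordinate subspace of `C`. -/
structure IsResidual (q : LinearMap.BilinForm ℝ (V → ℝ)) (C : Finset V) (R : V → V → ℝ) :
    Prop where
  eq_single : ∀ v, ∀ w ∉ C, R v w = (Pi.single v 1 : V → ℝ) w
  orthogonal : ∀ v, ∀ c ∈ C, q (R v) (Pi.single c 1) = 0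

namespace IsResidual

variable {q : LinearMap.BilinForm ℝ (V → ℝ)} {C : Finset V} {R : V → V → ℝ}

theorem self_pos (h : IsResidual q C R) (hq : ∀ x, x ≠ 0 → 0 < q x x) {k : V} (hk : k ∉ C) :
    0 < q (R k) (R k) := by
  refine hq _ fun h0 => ?_
  have := h.eq_single k k hk
  simp [h0] at this

theorem empty (q : LinearMap.BilinForm ℝ (V → ℝ)) :
    IsResidual q ∅ fun v => Pi.single v 1 where
  eq_single _ _ _ := rfl
  orthogonal _ _ h := absurd h (Finset.notMem_empty _)

/-- The update formula for partial covariances. -/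
theorem insert_apply (h : IsResidual q C R) (hq : ∀ x, x ≠ 0 → 0 < q x x)
    (hs : ∀ x y, q x y = q y x) {k : V} (hk : k ∉ C) (i j : V) :
    q (R i - (q (R i) (R k) / q (R k) (R k)) • R k) (R j - (q (R j) (R k) / q (R k) (R k)) • R k) =
      q (R i) (R j) - q (R i) (R k) * q (R k) (R j) / q (R k) (R k) := by
  have := (h.self_pos hq hk).ne'
  simp only [map_sub, map_smul, LinearMap.sub_apply, LinearMap.smul_apply, smul_eq_mul,
    hs (R j) (R k)]
  field_simp
  ring

variable [Fintype V]

theorem apply_eq_zero (h : IsResidual q C R) (v : V) {x : V → ℝ} (hx : ∀ w ∉ C, x w = 0) :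
    q (R v) x = 0 := by
  rw [pi_eq_sum_univ' x, map_sum]
  refine Finset.sum_eq_zero fun w _ => ?_
  by_cases hw : w ∈ C
  · rw [map_smul, h.orthogonal v w hw, smul_zero]
  · simp [hx w hw]

/-- The unit vector at `k` and `R k` differ by a vector supported on `C`, to which residuals are
orthogonal. -/
theorem apply_single (h : IsResidual q C R) (v k : V) :
    q (R v) (Pi.single k 1) = q (R v) (R k) := by
  rw [← sub_eq_zero, ← map_sub]
  refine h.apply_eq_zero v fun w hw => ?_
  simp [h.eq_single k w hw]

/-- One Gram–Schmidt step: the component along `R k` is removed. -/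
theorem insert (h : IsResidual q C R) (hq : ∀ x, x ≠ 0 → 0 < q x x) {k : V} (hk : k ∉ C) :
    IsResidual q (insert k C) fun v => R v - (q (R v) (R k) / q (R k) (R k)) • R k where
  eq_single v w hw := by
    rw [Finset.mem_insert, not_or] at hw
    simp [h.eq_single _ w hw.2, Pi.single_eq_of_ne hw.1]
  orthogonal v c hc := by
    have := (h.self_pos hq hk).ne'
    rcases Finset.mem_insert.1 hc with rfl | hc
    · simp only [map_sub, map_smul, LinearMap.sub_apply, LinearMap.smul_apply, h.apply_single,
        smul_eq_mul]
      field_simp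
      ring
    · simp [h.orthogonal _ c hc]

theorem exists_residual (hq : ∀ x, x ≠ 0 → 0 < q x x) (C : Finset V) :
    ∃ R, IsResidual q C R := by
  induction C using Finset.induction_on with
  | empty => exact ⟨_, empty q⟩
  | insert k C hk ih => exact ⟨_, ih.choose_spec.insert hq hk⟩

end IsResidual

end Residual

/-! ### Linear functionals of a Gaussian vector. -/

section Gaussian

open Matrix

variable {V : Type*} [Fintype V] [DecidableEq V] {m : EuclideanSpace ℝ V} {S : Matrix V V ℝ}

theorem covariance_dotProduct_multivariateGaussian (hS : S.PosSemidef) (a b : V → ℝ) :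
    cov[fun x : EuclideanSpace ℝ V => a ⬝ᵥ x, fun x => b ⬝ᵥ x; multivariateGaussian m S] =
      Matrix.toBilin' S a b := by
  have e (a : V → ℝ) : (fun x : EuclideanSpace ℝ V => a ⬝ᵥ x) =
      fun x => inner ℝ (WithLp.toLp 2 a) x := by
    ext x; simp [PiLp.inner_apply, dotProduct, mul_comm]
  rw [e, e, ← covarianceBilin_apply_eq_cov IsGaussian.memLp_two_id,
    covarianceBilin_multivariateGaussian hS, Matrix.toBilin'_apply']

theorem memLp_two_dotProduct_multivariateGaussian (a : V → ℝ) :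
    MemLp (fun x : EuclideanSpace ℝ V => a ⬝ᵥ x) 2 (multivariateGaussian m S) := by
  let L : EuclideanSpace ℝ V →ₗ[ℝ] ℝ :=
    { toFun := fun x => a ⬝ᵥ x
      map_add' := fun x y => by simp [dotProduct_add]
      map_smul' := fun c x => by simp [dotProduct_smul] }
  exact ((IsGaussian.hasGaussianLaw_id (μ := multivariateGaussian m S)).map_fun
    L.toContinuousLinearMap).memLp_two

theorem indepFun_dotProduct_multivariateGaussian (hS : S.PosSemidef) {ι κ : Type*} [Finite ι]
    [Finite κ] (a : ι → V → ℝ) (b : κ → V → ℝ)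
    (h : ∀ i j, Matrix.toBilin' S (a i) (b j) = 0) :
    IndepFun (fun (x : EuclideanSpace ℝ V) i => a i ⬝ᵥ x) (fun x j => b j ⬝ᵥ x)
      (multivariateGaussian m S) := by
  cases nonempty_fintype ι
  cases nonempty_fintype κ
  refine HasGaussianLaw.indepFun_of_covariance_eval (X := fun i (x : EuclideanSpace ℝ V) => a i ⬝ᵥ x)
    (Y := fun j x => b j ⬝ᵥ x) ?_ fun i j => ?_
  · let L : EuclideanSpace ℝ V →ₗ[ℝ] (ι → ℝ) × (κ → ℝ) :=
      { toFun := fun x => (fun i => a i ⬝ᵥ x, fun j => b j ⬝ᵥ x)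
        map_add' := fun x y => by ext <;> simp [dotProduct_add]
        map_smul' := fun c x => by ext <;> simp [dotProduct_smul] }
    exact (IsGaussian.hasGaussianLaw_id (μ := multivariateGaussian m S)).map_fun
      L.toContinuousLinearMap
  · rw [covariance_dotProduct_multivariateGaussian hS, h]

end Gaussian

/-! ### Conditional independence as vanishing of partial covariances. -/

section Gaussian

open Matrix

variable {V : Type*} [Fintype V]

/-- The vector of residuals of the coordinates in `A`. -/
def residualVector (R : V → V → ℝ) (A : Finset V) (x : EuclideanSpace ℝ V) : A → ℝ :=
  fun i => R i ⬝ᵥ x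

theorem measurable_residualVector (R : V → V → ℝ) (A : Finset V) :
    Measurable (residualVector R A) := by
  unfold residualVector dotProduct
  fun_prop

variable [DecidableEq V] {S : Matrix V V ℝ}

theorem Matrix.PosDef.toBilin'_self_pos (hS : S.PosDef) (x : V → ℝ) (hx : x ≠ 0) :
    0 < Matrix.toBilin' S x x := by
  rw [Matrix.toBilin'_apply']
  simpa using hS.dotProduct_mulVec_pos hx

theorem Matrix.PosDef.toBilin'_comm (hS : S.PosDef) (x y : V → ℝ) :
    Matrix.toBilin' S x y = Matrix.toBilin' S y x := by
  have h : Sᵀ = S := by simpa using hS.isHermitian.eq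
  rw [Matrix.toBilin'_apply', Matrix.toBilin'_apply', dotProduct_mulVec, dotProduct_comm,
    ← mulVec_transpose, h]

/-- Off `C`, `R i` is the unit vector at `i`. Read in both directions, the formula makes residuals
and coordinates interchangeable modulo `X_C`. -/
theorem IsResidual.dotProduct_eq {C : Finset V} {R : V → V → ℝ}
    {q : LinearMap.BilinForm ℝ (V → ℝ)} (hR : IsResidual q C R) (i : V)
    (hi : i ∉ C) (x : V → ℝ) : R i ⬝ᵥ x = x i + ∑ c : C, R i c * x c := by
  rw [dotProduct, ← Finset.sum_compl_add_sum C, ← Finset.sum_coe_sort C]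
  congr 1
  rw [Finset.sum_eq_single i]
  · rw [hR.eq_single i i hi, Pi.single_eq_same, one_mul]
  · intro w hw hwi
    rw [hR.eq_single i w (Finset.mem_compl.1 hw), Pi.single_eq_of_ne hwi, zero_mul]
  · intro h
    exact absurd (Finset.mem_compl.2 hi) h

variable {q : LinearMap.BilinForm ℝ (V → ℝ)} {A C : Finset V} {R : V → V → ℝ}

theorem comap_residualVector_le (hR : IsResidual q C R) (hA : Disjoint A C) :
    MeasurableSpace.comap (residualVector R A) inferInstance ≤
      MeasurableSpace.comap (subvector A) inferInstance ⊔
        MeasurableSpace.comap (subvector C) inferInstance := by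
  rw [← measurable_iff_comap_le]
  refine @measurable_pi_lambda _ _ _ (_) _ _ fun i => ?_
  have e : (fun x => residualVector R A x i) =
      fun x => subvector A x i + ∑ c : C, R i c * subvector C x c := by
    ext x
    exact hR.dotProduct_eq i (Finset.disjoint_left.1 hA i.2) x
  rw [e]
  have h₁ := (comap_measurable (subvector A)).mono (le_sup_left (a :=
    MeasurableSpace.comap (subvector A) inferInstance)
    (b := MeasurableSpace.comap (subvector C) inferInstance)) le_rfl
  have h₂ := (comap_measurable (subvector C)).mono (le_sup_right (a :=
    MeasurableSpace.comap (subvector A) inferInstance)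
    (b := MeasurableSpace.comap (subvector C) inferInstance)) le_rfl
  refine Measurable.add ((measurable_pi_apply i).comp h₁) ?_
  exact Finset.measurable_fun_sum _ fun c _ => ((measurable_pi_apply c).comp h₂).const_mul _

theorem comap_subvector_le (hR : IsResidual q C R) (hA : Disjoint A C) :
    MeasurableSpace.comap (subvector A) inferInstance ≤
      MeasurableSpace.comap (residualVector R A) inferInstance ⊔
        MeasurableSpace.comap (subvector C) inferInstance := by
  rw [← measurable_iff_comap_le]
  refine @measurable_pi_lambda _ _ _ (_) _ _ fun i => ?_
  have e : (fun x => subvector A x i) =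
      fun x => residualVector R A x i - ∑ c : C, R i c * subvector C x c := by
    ext x
    rw [eq_sub_iff_add_eq]
    exact (hR.dotProduct_eq i (Finset.disjoint_left.1 hA i.2) x).symm
  rw [e]
  have h₁ := (comap_measurable (residualVector R A)).mono (le_sup_left (a :=
    MeasurableSpace.comap (residualVector R A) inferInstance)
    (b := MeasurableSpace.comap (subvector C) inferInstance)) le_rfl
  have h₂ := (comap_measurable (subvector C)).mono (le_sup_right (a :=
    MeasurableSpace.comap (residualVector R A) inferInstance)
    (b := MeasurableSpace.comap (subvector C) inferInstance)) le_rfl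
  refine Measurable.sub ((measurable_pi_apply i).comp h₁) ?_
  exact Finset.measurable_fun_sum _ fun c _ => ((measurable_pi_apply c).comp h₂).const_mul _

/-- For a regular Gaussian distribution, conditional independence of subvectors means that all the
partial covariances vanish. -/
theorem condIndepSubvectors_multivariateGaussian_iff (m : EuclideanSpace ℝ V) (hS : S.PosDef)
    {A B C : Finset V} (hA : Disjoint A C) (hB : Disjoint B C) {R : V → V → ℝ}
    (hR : IsResidual (Matrix.toBilin' S) C R) :
    CondIndepSubvectors (multivariateGaussian m S) A B C ↔
      ∀ i ∈ A, ∀ j ∈ B, Matrix.toBilin' S (R i) (R j) = 0 := by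
  have hle := measurable_residualVector R
  -- The vector of all residuals dominates those of `A` and `B` together, so a single
  -- uncorrelatedness argument gives their joint independence from `X_C`.
  have hX : ∀ A : Finset V, MeasurableSpace.comap (residualVector R A) inferInstance ≤
      MeasurableSpace.comap (residualVector R Finset.univ) inferInstance := by
    intro A
    rw [← measurable_iff_comap_le]
    refine @measurable_pi_lambda _ _ _ (_) _ _ fun i => ?_
    exact (measurable_pi_apply (⟨i, Finset.mem_univ _⟩ : (Finset.univ : Finset V))).comp
      (comap_measurable (residualVector R Finset.univ))
  have hC : Indep (MeasurableSpace.comap (residualVector R A) inferInstance ⊔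
      MeasurableSpace.comap (residualVector R B) inferInstance)
      (MeasurableSpace.comap (subvector C) inferInstance) (multivariateGaussian m S) := by
    refine indep_of_indep_of_le_left ?_ (sup_le (hX A) (hX B))
    have := indepFun_dotProduct_multivariateGaussian (m := m) hS.posSemidef
      (fun i : (Finset.univ : Finset V) => R i) (fun c : C => Pi.single (c : V) (1 : ℝ))
      fun i c => hR.orthogonal i c c.2
    simp only [single_one_dotProduct] at this
    exact this
  rw [CondIndepSubvectors, condIndepFun_iff_condIndep]
  -- Joining `X_C` to both sides permits exchanging coordinates and residuals; conditioning on `X_C`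
  -- then has no effect on the residuals.
  trans IndepFun (residualVector R A) (residualVector R B) (multivariateGaussian m S)
  · rw [IndepFun_iff_Indep, ← condIndep_iff_indep_of_indep_sup
      (measurable_subvector C).comap_le (hle A).comap_le (hle B).comap_le hC]
    constructor
    · intro h
      have h' := h.sup_conditioning (measurable_subvector C).comap_le
        (measurable_subvector A).comap_le (measurable_subvector B).comap_le
      exact condIndep_of_condIndep_of_le_right (condIndep_of_condIndep_of_le_left h'
        (comap_residualVector_le hR hA)) (comap_residualVector_le hR hB)
    · intro h
      have h' := h.sup_conditioning (measurable_subvector C).comap_le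
        (hle A).comap_le (hle B).comap_le
      exact condIndep_of_condIndep_of_le_right (condIndep_of_condIndep_of_le_left h'
        (comap_subvector_le hR hA)) (comap_subvector_le hR hB)
  · constructor
    · intro h i hi j hj
      rw [← covariance_dotProduct_multivariateGaussian (m := m) hS.posSemidef]
      have hij := h.comp (measurable_pi_apply (⟨i, hi⟩ : A)) (measurable_pi_apply (⟨j, hj⟩ : B))
      exact hij.covariance_eq_zero (memLp_two_dotProduct_multivariateGaussian _)
        (memLp_two_dotProduct_multivariateGaussian _)
    · intro h
      exact indepFun_dotProduct_multivariateGaussian hS.posSemidef (fun i : A => R i)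
        (fun j : B => R j) fun i j => h i i.2 j j.2

end Gaussian

/-! ### Pairwise independence rules and separation in simple graphs. -/

section PairwiseSeparation

variable {V : Type*}

/-- Every walk in `H` from `i` to `j` leaves the set `T`. -/
def SimpleGraph.NotLinkedIn (H : SimpleGraph V) (T : Set V) (i j : V) : Prop :=
  ∀ p : H.Walk i j, ∃ v ∈ p.support, v ∉ T

namespace SimpleGraph.NotLinkedIn

variable {H : SimpleGraph V} {T T' : Set V} {i j k : V}

theorem mono (h : H.NotLinkedIn T i j) (hT : T' ⊆ T) : H.NotLinkedIn T' i j := fun p =>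
  (h p).imp fun _ hv => ⟨hv.1, fun hv' => hv.2 (hT hv')⟩

theorem symm (h : H.NotLinkedIn T i j) : H.NotLinkedIn T j i := fun p => by
  simpa using h p.reverse

/-- Otherwise two walks inside `T` would concatenate at `k`. This supplies the case distinction
needed to apply `intersection` and `insert_of`. -/
theorem or_of (h : H.NotLinkedIn T i j) (k : V) :
    H.NotLinkedIn T i k ∨ H.NotLinkedIn T k j := by
  by_contra! hn
  simp only [NotLinkedIn] at hn
  push Not at hn
  obtain ⟨⟨p, hp⟩, ⟨r, hr⟩⟩ := hn
  obtain ⟨v, hv, hvT⟩ := h (p.append r)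
  rw [SimpleGraph.Walk.mem_support_append_iff] at hv
  exact hvT (hv.elim (hp v) (hr v))

theorem not_adj (h : H.NotLinkedIn T i j) (hi : i ∈ T) (hj : j ∈ T) : ¬ H.Adj i j := fun ha => by
  obtain ⟨v, hv, hvT⟩ := h ha.toWalk
  simp only [SimpleGraph.Walk.support_cons, SimpleGraph.Walk.support_nil, List.mem_cons,
    List.not_mem_nil, or_false, SimpleGraph.Adj.toWalk] at hv
  rcases hv with rfl | rfl
  · exact hvT hi
  · exact hvT hj

end SimpleGraph.NotLinkedIn

variable [DecidableEq V]

/-- The rules for pairwise conditional independence in a regular Gaussian distribution that relate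
independence given `C` to independence given `insert k C`. -/
structure IsGaussianPairwise (I : V → V → Finset V → Prop) : Prop where
  ne : ∀ {i j C}, I i j C → i ≠ j
  left_notMem : ∀ {i j C}, I i j C → i ∉ C
  right_notMem : ∀ {i j C}, I i j C → j ∉ C
  symm : ∀ {i j C}, I i j C → I j i C
  weak_transitivity : ∀ {i j k C}, k ≠ i → k ≠ j → k ∉ C → I i j C → I i j (insert k C) →
    I i k C ∨ I k j C
  intersection : ∀ {i j k C}, I i j (insert k C) → I i k (insert j C) → I i j C
  insert_of : ∀ {i j k C}, k ≠ i → k ≠ j → k ∉ C → I i j C → I i k C ∨ I k j C →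
    I i j (insert k C)

namespace IsGaussianPairwise

variable {I : V → V → Finset V → Prop} {H : SimpleGraph V}

/-! ### Upward-stable case. -/

section Upward

theorem mono
    (hu : ∀ i j C, I i j C → ∀ k, k ≠ i → k ≠ j → I i j (C ∪ {k})) {i j : V}
    {C D : Finset V} (h : I i j C) (hCD : C ⊆ D) (hi : i ∉ D) (hj : j ∉ D) : I i j D := by
  have key : ∀ E : Finset V, i ∉ E → j ∉ E → I i j (C ∪ E) := by
    intro E
    induction E using Finset.induction_on with
    | empty => simpa using h
    | insert k E _ ih =>
      intro hi hj
      rw [Finset.mem_insert, not_or] at hi hj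
      have := hu i j _ (ih hi.2 hj.2) k (Ne.symm hi.1) (Ne.symm hj.1)
      rwa [Finset.union_assoc, Finset.union_comm E, ← Finset.insert_eq] at this
  simpa [Finset.union_eq_right.2 hCD] using key D hi hj

variable [Fintype V]

/-- Let `k` follow `i` on the walk. Stability and weak transitivity turn independence of `i`, `j`
into that of `i`, `k`, which contradicts the edge after enlarging `C` to the full complement, or of
`k`, `j`, which contradicts induction. -/
theorem not_of_walk_compl (hI : IsGaussianPairwise I)
    (hu : ∀ i j C, I i j C → ∀ k, k ≠ i → k ≠ j → I i j (C ∪ {k}))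
    (hH : ∀ i j, H.Adj i j ↔ i ≠ j ∧ ¬ I i j {i, j}ᶜ) {C : Finset V} {i j : V}
    (p : H.Walk i j) (hp : ∀ v ∈ p.support, v ∉ C) : ¬ I i j C := by
  have adj : ∀ {i k}, H.Adj i k → ¬ I i k C := fun {i k} ha h =>
    ((hH i k).1 ha).2 (mono hu h (fun v hv => by
      simp only [Finset.mem_compl, Finset.mem_insert, Finset.mem_singleton, not_or]
      exact ⟨fun e => hI.left_notMem h (e ▸ hv), fun e => hI.right_notMem h (e ▸ hv)⟩)
      (by simp) (by simp))
  induction p with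
  | nil => exact fun h => hI.ne h rfl
  | @cons i k j ha p ih =>
    intro h
    rw [SimpleGraph.Walk.support_cons, List.forall_mem_cons] at hp
    by_cases hkj : k = j
    · exact adj ha (hkj ▸ h)
    · have h' := hu i j C h k ha.ne' hkj
      rw [Finset.union_comm, ← Finset.insert_eq] at h'
      rcases hI.weak_transitivity ha.ne' hkj (hp.2 k p.start_mem_support) h h' with h | h
      · exact adj ha h
      · exact ih hp.2 h

/-- The pairwise Markov property implies the global one through intersection, by descending
induction on `C`; the base case `C = {i, j}ᶜ` is the absence of an edge. -/
theorem of_notLinkedIn_compl (hI : IsGaussianPairwise I)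
    (hH : ∀ i j, H.Adj i j ↔ i ≠ j ∧ ¬ I i j {i, j}ᶜ) (n : ℕ) :
    ∀ (C : Finset V) (i j : V), Cᶜ.card = n → i ≠ j → i ∉ C → j ∉ C →
      H.NotLinkedIn {v | v ∉ C} i j → I i j C := by
  induction n using Nat.strong_induction_on with
  | _ n ih =>
  intro C i j hn hij hi hj h
  by_cases hC : ∃ k, k ∉ C ∧ k ≠ i ∧ k ≠ j
  · obtain ⟨k, hk, hki, hkj⟩ := hC
    have ih' : ∀ (u v w : V), u ∉ C → v ≠ w → v ≠ u → w ≠ u → v ∉ C → w ∉ C →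
        H.NotLinkedIn {v | v ∉ C} v w → I v w (insert u C) := by
      intro u v w hu hvw hvu hwu hv hw h
      refine ih _ ?_ (insert u C) v w rfl hvw (by simp [hvu, hv]) (by simp [hwu, hw])
        (h.mono fun x hx hxC => hx (Finset.mem_insert_of_mem hxC))
      rw [← hn]
      exact Finset.card_lt_card (Finset.compl_ssubset_compl.2 (Finset.ssubset_insert hu))
    have h₁ := ih' k i j hk hij hki.symm hkj.symm hi hj h
    rcases h.or_of k with h' | h'
    · exact hI.intersection h₁ (ih' j i k hj hki.symm hij hkj hi hk h')
    · exact hI.symm (hI.intersection (hI.symm h₁)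
        (ih' i j k hi hkj.symm hij.symm hki hj hk h'.symm))
  · have e : C = {i, j}ᶜ := by
      ext k
      simp only [Finset.mem_compl, Finset.mem_insert, Finset.mem_singleton]
      refine ⟨fun hk hij => hij.elim (fun e => hi (e ▸ hk)) fun e => hj (e ▸ hk), fun hk => ?_⟩
      by_contra hkC
      exact hC ⟨k, hkC, fun e => hk (Or.inl e), fun e => hk (Or.inr e)⟩
    have := h.not_adj hi hj
    rw [hH, not_and, not_not, ← e] at this
    exact this hij

theorem iff_notLinkedIn_compl (hI : IsGaussianPairwise I)
    (hu : ∀ i j C, I i j C → ∀ k, k ≠ i → k ≠ j → I i j (C ∪ {k}))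
    (hH : ∀ i j, H.Adj i j ↔ i ≠ j ∧ ¬ I i j {i, j}ᶜ) {C : Finset V} {i j : V}
    (hij : i ≠ j) (hi : i ∉ C) (hj : j ∉ C) : I i j C ↔ H.NotLinkedIn {v | v ∉ C} i j := by
  refine ⟨fun h p => ?_, hI.of_notLinkedIn_compl hH _ C i j rfl hij hi hj⟩
  by_contra! hp
  exact hI.not_of_walk_compl hu hH p hp h

end Upward

/-! ### Downward-stable case. -/

section Downward

theorem anti (hd : ∀ i j C, I i j C → ∀ k, k ≠ i → k ≠ j → I i j (C \ {k}))
    (hI : IsGaussianPairwise I) {i j : V}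
    {C D : Finset V} (h : I i j C) (hDC : D ⊆ C) : I i j D := by
  have key : ∀ E : Finset V, E ⊆ C → I i j (C \ E) := by
    intro E
    induction E using Finset.induction_on with
    | empty => simpa using h
    | insert k E _ ih =>
      intro hE
      rw [Finset.insert_subset_iff] at hE
      have := hd i j _ (ih hE.2) k (fun e => hI.left_notMem h (e ▸ hE.1))
        (fun e => hI.right_notMem h (e ▸ hE.1))
      rwa [sdiff_sdiff, Finset.sup_eq_union, Finset.union_comm, ← Finset.insert_eq] at this
  simpa [Finset.inter_eq_right.2 hDC] using key (C \ D) Finset.sdiff_subset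

/-- Weak transitivity is applied given `C.erase k`, where `k` follows `i`. On the tail `k` is an
endpoint and may leave `C`; being a path keeps the tail away from `i`. -/
theorem not_of_isPath (hI : IsGaussianPairwise I)
    (hd : ∀ i j C, I i j C → ∀ k, k ≠ i → k ≠ j → I i j (C \ {k}))
    (hH : ∀ i j, H.Adj i j ↔ i ≠ j ∧ ¬ I i j ∅) {i j : V}
    (p : H.Walk i j) (hpath : p.IsPath) {C : Finset V}
    (hp : ∀ v ∈ p.support, v ∈ C ∨ v = i ∨ v = j) : ¬ I i j C := by
  induction p generalizing C with
  | nil => exact fun h => hI.ne h rfl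
  | @cons i k j ha p ih =>
    intro h
    rw [SimpleGraph.Walk.cons_isPath_iff] at hpath
    rw [SimpleGraph.Walk.support_cons, List.forall_mem_cons] at hp
    by_cases hkj : k = j
    · exact ((hH i k).1 ha).2 (hkj ▸ hI.anti hd h (Finset.empty_subset C))
    · have hk : k ∈ C := by
        rcases hp.2 k p.start_mem_support with h | h | h
        · exact h
        · exact absurd h ha.ne'
        · exact absurd h hkj
      have h' := hI.anti hd h (Finset.erase_subset k C)
      rcases hI.weak_transitivity ha.ne' hkj (Finset.notMem_erase k C) h'
        (by rwa [Finset.insert_erase hk]) with h | h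
      · exact ((hH i k).1 ha).2 (hI.anti hd h (Finset.empty_subset _))
      · refine ih hpath.1 (fun v hv => ?_) h
        by_cases hvk : v = k
        · exact Or.inr (Or.inl hvk)
        · rcases hp.2 v hv with h | h | h
          · exact Or.inl (Finset.mem_erase.2 ⟨hvk, h⟩)
          · exact absurd (h ▸ hv) hpath.2
          · exact Or.inr (Or.inr h)

/-- When `k` joins `C`, one of the pairs `i`, `k` and `k`, `j` is also unlinked, so by induction the
correction to the partial covariance vanishes, as `insert_of` records. -/
theorem of_notLinkedIn_union (hI : IsGaussianPairwise I)
    (hH : ∀ i j, H.Adj i j ↔ i ≠ j ∧ ¬ I i j ∅) (C : Finset V) :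
    ∀ (i j : V), i ≠ j → i ∉ C → j ∉ C →
      H.NotLinkedIn {v | v ∈ C ∨ v = i ∨ v = j} i j → I i j C := by
  induction C using Finset.induction_on with
  | empty =>
    intro i j hij _ _ h
    have := h.not_adj (by simp) (by simp)
    rw [hH, not_and, not_not] at this
    exact this hij
  | insert k C hk ih =>
    intro i j hij hi hj h
    rw [Finset.mem_insert, not_or] at hi hj
    refine hI.insert_of (Ne.symm hi.1) (Ne.symm hj.1) hk (ih i j hij hi.2 hj.2 (h.mono ?_)) ?_
    · rintro v (hv | hv)
      · exact Or.inl (Finset.mem_insert_of_mem hv)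
      · exact Or.inr hv
    · refine (h.or_of k).imp (fun h => ih i k hi.1 hi.2 hk (h.mono ?_))
        (fun h => ih k j (Ne.symm hj.1) hk hj.2 (h.mono ?_))
      · rintro v (hv | hv | hv) <;> simp [hv]
      · rintro v (hv | hv | hv) <;> simp [hv]

theorem iff_notLinkedIn_union (hI : IsGaussianPairwise I)
    (hd : ∀ i j C, I i j C → ∀ k, k ≠ i → k ≠ j → I i j (C \ {k}))
    (hH : ∀ i j, H.Adj i j ↔ i ≠ j ∧ ¬ I i j ∅) {C : Finset V} {i j : V}
    (hij : i ≠ j) (hi : i ∉ C) (hj : j ∉ C) :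
    I i j C ↔ H.NotLinkedIn {v | v ∈ C ∨ v = i ∨ v = j} i j := by
  refine ⟨fun h p => ?_, hI.of_notLinkedIn_union hH C i j hij hi hj⟩
  by_contra! hp
  exact hI.not_of_isPath hd hH p.bypass p.bypass_isPath
    (fun v hv => hp v (p.support_bypass_subset_support hv)) h

end Downward

end IsGaussianPairwise

end PairwiseSeparation

/-! ### Gaussian distributions satisfy the pairwise rules. -/

section GaussianRules

variable {V : Type*} [Fintype V]

theorem isGaussianPairwise_probIndepModel [DecidableEq V] {P : Measure (EuclideanSpace ℝ V)}
    [IsProbabilityMeasure P] (hP : IsRegularGaussian P) :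
    IsGaussianPairwise fun i j C => (probIndepModel P).Indep {i} {j} C := by
  obtain ⟨m, S, hS, rfl⟩ := hP
  set q := Matrix.toBilin' S
  have hq := hS.toBilin'_self_pos
  have hs := hS.toBilin'_comm
  have iff_of : ∀ {C R}, IsResidual q C R → ∀ i j,
      (probIndepModel (multivariateGaussian m S)).Indep {i} {j} C ↔
        i ≠ j ∧ i ∉ C ∧ j ∉ C ∧ q (R i) (R j) = 0 := by
    intro C R hR i j
    change _ ∧ _ ↔ _
    rw [Finset.disjoint_singleton, Finset.disjoint_singleton_left,
      Finset.disjoint_singleton_left, and_assoc, and_assoc]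
    refine and_congr_right fun _ => and_congr_right fun hi => and_congr_right fun hj => ?_
    rw [condIndepSubvectors_multivariateGaussian_iff m hS (by simpa) (by simpa) hR]
    simp [q]
  have iff_insert : ∀ {C R}, IsResidual q C R → ∀ {k}, k ∉ C → ∀ i j,
      (probIndepModel (multivariateGaussian m S)).Indep {i} {j} (insert k C) ↔
        i ≠ j ∧ i ∉ insert k C ∧ j ∉ insert k C ∧
          q (R i) (R j) * q (R k) (R k) = q (R i) (R k) * q (R k) (R j) := by
    intro C R hR k hk i j
    have := (hR.self_pos hq hk).ne'
    rw [iff_of (hR.insert hq hk), hR.insert_apply hq hs hk, sub_eq_zero, eq_div_iff this]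
  refine
    { ne := fun h => Finset.disjoint_singleton.1 h.1.1
      left_notMem := fun h => Finset.disjoint_singleton_left.1 h.1.2.1
      right_notMem := fun h => Finset.disjoint_singleton_left.1 h.1.2.2
      symm := fun {i j C} h => ⟨⟨h.1.1.symm, h.1.2.2, h.1.2.1⟩, CondIndepFun.symm h.2⟩
      weak_transitivity := ?_
      intersection := ?_
      insert_of := ?_ }
  · intro i j k C hki hkj hk h h'
    obtain ⟨R, hR⟩ := IsResidual.exists_residual hq C
    rw [iff_of hR] at h ⊢
    rw [iff_of hR]
    rw [iff_insert hR hk] at h'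
    have := h'.2.2.2
    rw [h.2.2.2, zero_mul, eq_comm, mul_eq_zero] at this
    exact this.imp (fun e => ⟨hki.symm, h.2.1, hk, e⟩) fun e => ⟨hkj, hk, h.2.2.1, e⟩
  · intro i j k C h h'
    obtain ⟨R, hR⟩ := IsResidual.exists_residual hq C
    have hk : k ∉ C := fun e =>
      Finset.disjoint_singleton_left.1 h'.1.2.2 (Finset.mem_insert_of_mem e)
    have hj : j ∉ C := fun e =>
      Finset.disjoint_singleton_left.1 h.1.2.2 (Finset.mem_insert_of_mem e)
    rw [iff_insert hR hk] at h
    rw [iff_insert hR hj] at h'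
    rw [iff_of hR]
    obtain ⟨hij, hi, hjk, e⟩ := h
    refine ⟨hij, fun hi' => hi (Finset.mem_insert_of_mem hi'), hj, ?_⟩
    -- The two hypotheses combine to the partial covariance of `i`, `j` given `C` times the partial
    -- variance of `j` given `insert k C`; the latter is positive.
    have hpos := (hR.insert hq hk).self_pos hq hjk
    rw [hR.insert_apply hq hs hk] at hpos
    have hk' : q (R k) (R k) ≠ 0 := (hR.self_pos hq hk).ne'
    have e' := h'.2.2.2
    have : q (R i) (R j) * (q (R j) (R j) - q (R j) (R k) * q (R k) (R j) / q (R k) (R k)) = 0 := by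
      field_simp
      linear_combination q (R j) (R j) * e + q (R k) (R j) * e'
    exact (mul_eq_zero.1 this).resolve_right hpos.ne'
  · intro i j k C hki hkj hk h h'
    obtain ⟨R, hR⟩ := IsResidual.exists_residual hq C
    rw [iff_of hR] at h
    rw [iff_of hR, iff_of hR] at h'
    rw [iff_insert hR hk]
    refine ⟨h.1, by simp [hki.symm, h.2.1], by simp [hkj.symm, h.2.2.1], ?_⟩
    rcases h' with h' | h' <;> simp [h.2.2.2, h'.2.2.2]

/-- The residuals depend only on `C`, and the vanishing criterion is a conjunction over pairs. -/
theorem probIndepModel_indep_iff_forall [DecidableEq V] {P : Measure (EuclideanSpace ℝ V)}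
    [IsProbabilityMeasure P] (hP : IsRegularGaussian P) {A B C : Finset V} (hAB : Disjoint A B)
    (hAC : Disjoint A C) (hBC : Disjoint B C) :
    (probIndepModel P).Indep A B C ↔
      ∀ i ∈ A, ∀ j ∈ B, (probIndepModel P).Indep {i} {j} C := by
  obtain ⟨m, S, hS, rfl⟩ := hP
  obtain ⟨R, hR⟩ := IsResidual.exists_residual hS.toBilin'_self_pos C
  change _ ∧ _ ↔ ∀ i ∈ A, ∀ j ∈ B, _ ∧ _
  rw [condIndepSubvectors_multivariateGaussian_iff m hS hAC hBC hR]
  refine ⟨fun h i hi j hj => ?_, fun h => ⟨⟨hAB, hAC, hBC⟩, fun i hi j hj => ?_⟩⟩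
  · have hiC : Disjoint {i} C := Finset.disjoint_singleton_left.2 (Finset.disjoint_left.1 hAC hi)
    have hjC : Disjoint {j} C := Finset.disjoint_singleton_left.2 (Finset.disjoint_left.1 hBC hj)
    refine ⟨⟨Finset.disjoint_singleton.2 (Finset.disjoint_iff_ne.1 hAB i hi j hj), hiC, hjC⟩, ?_⟩
    rw [condIndepSubvectors_multivariateGaussian_iff m hS hiC hjC hR]
    simpa using h.2 i hi j hj
  · obtain ⟨⟨-, hiC, hjC⟩, hc⟩ := h i hi j hj
    rw [condIndepSubvectors_multivariateGaussian_iff m hS hiC hjC hR] at hc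
    simpa using hc

end GaussianRules

/-! ### Connecting walks in undirected and bidirected graphs. -/

section GraphSeparation

variable {V : Type*}

theorem SimpleGraph.exists_walk_of_forall_adj (H : SimpleGraph V) (f : ℕ → V) (n : ℕ)
    (h : ∀ k < n, H.Adj (f k) (f (k + 1))) :
    ∃ p : H.Walk (f 0) (f n), ∀ v ∈ p.support, ∃ k ≤ n, v = f k := by
  induction n with
  | zero => exact ⟨.nil, fun v hv => ⟨0, le_rfl, by simpa using hv⟩⟩
  | succ n ih =>
    obtain ⟨p, hp⟩ := ih fun k hk => h k (by omega)
    refine ⟨p.concat (h n (by omega)), fun v hv => ?_⟩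
    rw [SimpleGraph.Walk.support_concat, List.mem_append, List.mem_singleton] at hv
    rcases hv with hv | hv
    · obtain ⟨k, hk, e⟩ := hp v hv
      exact ⟨k, by omega, e⟩
    · exact ⟨n + 1, le_rfl, hv⟩

namespace MixedGraph

variable (G : MixedGraph V) {A B C : Finset V}

/-- The simple graph of the lines of a mixed graph. -/
def lineGraph : SimpleGraph V where
  Adj := G.Line
  symm := ⟨fun _ _ h => G.line_symm h⟩
  loopless := ⟨G.line_irrefl⟩

/-- The simple graph of the arcs of a mixed graph. -/
def arcGraph : SimpleGraph V where
  Adj := G.Arc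
  symm := ⟨fun _ _ h => G.arc_symm h⟩
  loopless := ⟨G.arc_irrefl⟩

variable {G}

theorem IsUndirected.step_eq_line (hG : G.IsUndirected) {s : Step} {u v : V}
    (h : G.HasStep s u v) : s = .line := by
  cases s with
  | line => rfl
  | forward => exact absurd h (hG _ _).1
  | backward => exact absurd h (hG _ _).1
  | arc => exact absurd h (hG _ _).2

theorem IsBidirected.step_eq_arc (hG : G.IsBidirected) {s : Step} {u v : V}
    (h : G.HasStep s u v) : s = .arc := by
  cases s with
  | line => exact absurd h (hG _ _).1
  | forward => exact absurd h (hG _ _).2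
  | backward => exact absurd h (hG _ _).2
  | arc => rfl

/-- The whole walk is one section, and it is not a collider since no edge enters it. -/
theorem IsUndirected.isConnecting_iff (hG : G.IsUndirected) (w : G.Walk) :
    w.IsConnecting C ↔ ∀ k ≤ w.length, w.node k ∉ C := by
  have hl : ∀ k < w.length, w.step k = .line := fun k hk => hG.step_eq_line (w.valid k hk)
  have hs : ∀ a b, w.IsSection a b ↔ a = 0 ∧ b = w.length := by
    intro a b
    constructor
    · rintro ⟨hab, hb, -, h₁, h₂⟩
      have hb' : b = w.length := by
        by_contra hne
        have : b < w.length := by omega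
        exact h₂ this (hl b this)
      refine ⟨?_, hb'⟩
      by_contra ha
      exact h₁ (a - 1) (by omega) (hl _ (by omega))
    · rintro ⟨rfl, rfl⟩
      exact ⟨Nat.zero_le _, le_rfl, fun k _ hk => hl k hk, fun k hk => by omega,
        fun h => absurd h (lt_irrefl _)⟩
  have hc : ¬ w.IsColliderSection 0 w.length := by
    rintro ⟨-, ⟨k, hk, -⟩, -⟩
    omega
  constructor
  · intro h k hk
    exact (h 0 w.length ((hs _ _).2 ⟨rfl, rfl⟩)).2 hc k (Nat.zero_le _) hk
  · intro h a b hab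
    obtain ⟨rfl, rfl⟩ := (hs _ _).1 hab
    exact ⟨fun h => absurd h hc, fun _ k _ hk => h k hk⟩

/-- Sections are single positions; exactly the interior ones are colliders. -/
theorem IsBidirected.isConnecting_iff (hG : G.IsBidirected) (w : G.Walk) :
    w.IsConnecting C ↔ w.node 0 ∉ C ∧ w.node w.length ∉ C ∧
      ∀ k, 0 < k → k < w.length → w.node k ∈ C := by
  have hl : ∀ k < w.length, w.step k = .arc := fun k hk => hG.step_eq_arc (w.valid k hk)
  have hs : ∀ a b, w.IsSection a b ↔ a = b ∧ b ≤ w.length := by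
    intro a b
    constructor
    · rintro ⟨hab, hb, h, -, -⟩
      refine ⟨?_, hb⟩
      by_contra hne
      have := (hl a (by omega)).symm.trans (h a le_rfl (by omega))
      cases this
    · rintro ⟨rfl, h⟩
      refine ⟨le_rfl, h, fun k h₁ h₂ => by omega, fun k hk => ?_, fun ha => ?_⟩
      · rw [hl k (by omega)]
        exact Step.noConfusion
      · rw [hl a ha]
        exact Step.noConfusion
  have hc : ∀ a, w.IsColliderSection a a ↔ 0 < a ∧ a < w.length := by
    intro a
    constructor
    · rintro ⟨-, ⟨k, hk, -⟩, h, -⟩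
      exact ⟨by omega, h⟩
    · rintro ⟨h₀, h₁⟩
      refine ⟨(hs a a).2 ⟨rfl, h₁.le⟩, ⟨a - 1, by omega, ?_⟩, h₁, ?_⟩
      · rw [hl _ (by omega)]
        trivial
      · rw [hl _ h₁]
        trivial
  constructor
  · intro h
    refine ⟨?_, ?_, fun k h₀ h₁ => ?_⟩
    · exact (h 0 0 ((hs _ _).2 ⟨rfl, Nat.zero_le _⟩)).2 (by simp [hc]) 0 le_rfl le_rfl
    · exact (h _ _ ((hs _ _).2 ⟨rfl, le_rfl⟩)).2 (by simp [hc]) _ le_rfl le_rfl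
    · obtain ⟨l, hl₁, hl₂, hl₃⟩ :=
        (h k k ((hs _ _).2 ⟨rfl, h₁.le⟩)).1 ((hc k).2 ⟨h₀, h₁⟩)
      rwa [le_antisymm hl₂ hl₁] at hl₃
  · rintro ⟨h₀, h₁, h⟩ a b hab
    obtain ⟨rfl, ha⟩ := (hs _ _).1 hab
    rw [hc]
    refine ⟨fun hk => ⟨a, le_rfl, le_rfl, h a hk.1 hk.2⟩, fun hk k hk₁ hk₂ => ?_⟩
    obtain rfl := le_antisymm hk₂ hk₁
    rcases Nat.eq_zero_or_pos k with rfl | hpos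
    · exact h₀
    · rwa [show k = w.length by omega]

theorem IsUndirected.separated_iff (hG : G.IsUndirected) :
    G.Separated A B C ↔
      ∀ i ∈ A, ∀ j ∈ B, G.lineGraph.NotLinkedIn {v | v ∉ C} i j := by
  constructor
  · intro h i hi j hj p
    by_contra! hp
    refine h ⟨⟨p.length, p.getVert, fun _ => .line, fun k hk => p.adj_getVert_succ hk⟩, ?_, ?_, ?_⟩
    · simpa using hi
    · simpa using hj
    · rw [hG.isConnecting_iff]
      exact fun k _ => hp _ (p.getVert_mem_support k)
  · rintro h ⟨w, h₀, h₁, hw⟩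
    rw [hG.isConnecting_iff] at hw
    obtain ⟨p, hp⟩ := G.lineGraph.exists_walk_of_forall_adj w.node w.length fun k hk => by
      have := w.valid k hk
      rwa [hG.step_eq_line this] at this
    obtain ⟨v, hv, hvC⟩ := h _ h₀ _ h₁ p
    obtain ⟨k, hk, rfl⟩ := hp v hv
    exact hvC (hw k hk)

theorem IsBidirected.separated_iff (hG : G.IsBidirected) (hA : Disjoint A C)
    (hB : Disjoint B C) :
    G.Separated A B C ↔
      ∀ i ∈ A, ∀ j ∈ B, G.arcGraph.NotLinkedIn {v | v ∈ C ∨ v = i ∨ v = j} i j := by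
  classical
  constructor
  · intro h i hi j hj p'
    by_contra! hp
    -- On a path the interior nodes differ from `i` and `j`, so they must lie in `C`.
    have hpath := p'.bypass_isPath
    replace hp := fun v hv => hp v (p'.support_bypass_subset_support hv)
    generalize p'.bypass = p at hp hpath
    refine h ⟨⟨p.length, p.getVert, fun _ => .arc, fun k hk => p.adj_getVert_succ hk⟩, ?_, ?_, ?_⟩
    · simpa using hi
    · simpa using hj
    · rw [hG.isConnecting_iff]
      refine ⟨?_, ?_, fun k h₀ h₁ => ?_⟩
      · simpa using Finset.disjoint_left.1 hA hi
      · simpa using Finset.disjoint_left.1 hB hj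
      · rcases hp _ (p.getVert_mem_support k) with h | h | h
        · exact h
        · exact absurd ((hpath.getVert_eq_start_iff h₁.le).1 h) h₀.ne'
        · exact absurd ((hpath.getVert_eq_end_iff h₁.le).1 h) h₁.ne
  · rintro h ⟨w, h₀, h₁, hw⟩
    rw [hG.isConnecting_iff] at hw
    obtain ⟨p, hp⟩ := G.arcGraph.exists_walk_of_forall_adj w.node w.length fun k hk => by
      have := w.valid k hk
      rwa [hG.step_eq_arc this] at this
    obtain ⟨v, hv, hvC⟩ := h _ h₀ _ h₁ p
    obtain ⟨k, hk, rfl⟩ := hp v hv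
    refine hvC ?_
    rcases Nat.eq_zero_or_pos k with rfl | hpos
    · exact Or.inr (Or.inl rfl)
    · rcases hk.eq_or_lt with rfl | hk
      · exact Or.inr (Or.inr rfl)
      · exact Or.inl (hw.2.2 k hpos hk)

theorem separated_iff_forall : G.Separated A B C ↔ ∀ i ∈ A, ∀ j ∈ B, G.Separated {i} {j} C := by
  constructor
  · rintro h i hi j hj ⟨w, h₀, h₁, hw⟩
    rw [Finset.mem_singleton] at h₀ h₁
    exact h ⟨w, h₀ ▸ hi, h₁ ▸ hj, hw⟩
  · rintro h ⟨w, h₀, h₁, hw⟩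
    exact h _ h₀ _ h₁ ⟨w, Finset.mem_singleton_self _, Finset.mem_singleton_self _, hw⟩

theorem IsUndirected.upwardStable [DecidableEq V] (hG : G.IsUndirected) :
    G.indepModel.UpwardStable := by
  rintro i j C ⟨⟨hij, hi, hj⟩, h⟩ k hki hkj
  refine ⟨⟨hij, by simp_all [eq_comm], by simp_all [eq_comm]⟩, ?_⟩
  rw [hG.separated_iff] at h ⊢
  exact fun i hi j hj => (h i hi j hj).mono fun v hv hvC => hv (Finset.mem_union_left _ hvC)

theorem IsBidirected.downwardStable [DecidableEq V] (hG : G.IsBidirected) :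
    G.indepModel.DownwardStable := by
  rintro i j C ⟨⟨hij, hi, hj⟩, h⟩ k hki hkj
  have hi' : Disjoint {i} (C \ {k}) := hi.mono_right Finset.sdiff_subset
  have hj' : Disjoint {j} (C \ {k}) := hj.mono_right Finset.sdiff_subset
  refine ⟨⟨hij, hi', hj'⟩, ?_⟩
  rw [hG.separated_iff hi hj] at h
  rw [hG.separated_iff hi' hj']
  exact fun i hi j hj => (h i hi j hj).mono fun v hv =>
    hv.imp_left fun hv => Finset.sdiff_subset hv

end MixedGraph

theorem faithfulTo_of_pairwise [Fintype V] [DecidableEq V] {P : Measure (EuclideanSpace ℝ V)}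
    [IsProbabilityMeasure P] (hP : IsRegularGaussian P) {G : MixedGraph V}
    (h : ∀ i j C, i ≠ j → i ∉ C → j ∉ C →
      ((probIndepModel P).Indep {i} {j} C ↔ G.Separated {i} {j} C)) : FaithfulTo P G := by
  apply IndependenceModel.ext
  funext A B C
  refine propext ⟨fun H => ?_, fun H => ?_⟩ <;> obtain ⟨hAB, hAC, hBC⟩ := H.1
  · refine ⟨H.1, MixedGraph.separated_iff_forall.2 fun i hi j hj => ?_⟩
    rw [probIndepModel_indep_iff_forall hP hAB hAC hBC] at H
    exact (h i j C (Finset.disjoint_iff_ne.1 hAB i hi j hj) (Finset.disjoint_left.1 hAC hi)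
      (Finset.disjoint_left.1 hBC hj)).1 (H i hi j hj)
  · rw [probIndepModel_indep_iff_forall hP hAB hAC hBC]
    exact fun i hi j hj => (h i j C (Finset.disjoint_iff_ne.1 hAB i hi j hj)
      (Finset.disjoint_left.1 hAC hi) (Finset.disjoint_left.1 hBC hj)).2
      (MixedGraph.separated_iff_forall.1 H.2 i hi j hj)

end GraphSeparation

/-! ### The two characterizations of faithfulness. -/

theorem mainTheorem9 {V : Type*} [Fintype V] [DecidableEq V]
    (P : Measure (EuclideanSpace ℝ V)) [IsProbabilityMeasure P] (hP : IsRegularGaussian P) :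
    ((∃ G : MixedGraph V, G.IsUndirected ∧ FaithfulTo P G) ↔ (probIndepModel P).UpwardStable) ∧
    ((∃ G : MixedGraph V, G.IsBidirected ∧ FaithfulTo P G) ↔
      (probIndepModel P).DownwardStable) := by
  have hI := isGaussianPairwise_probIndepModel hP
  refine ⟨⟨?_, fun hu => ?_⟩, ⟨?_, fun hd => ?_⟩⟩
  · rintro ⟨G, hG, h⟩
    rw [FaithfulTo] at h
    exact h ▸ hG.upwardStable
  -- The concentration graph: lines record dependence given all remaining nodes.
  · let G : MixedGraph V :=
      { Line := fun i j => i ≠ j ∧ ¬ (probIndepModel P).Indep {i} {j} {i, j}ᶜ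
        Arrow := fun _ _ => False
        Arc := fun _ _ => False
        line_symm := fun {i j} h =>
          ⟨h.1.symm, fun h' => h.2 (by rw [Finset.pair_comm]; exact hI.symm h')⟩
        arc_symm := id
        line_irrefl := fun _ h => h.1 rfl
        arrow_irrefl := fun _ => id
        arc_irrefl := fun _ => id }
    have hG : G.IsUndirected := fun _ _ => ⟨id, id⟩
    refine ⟨G, hG, faithfulTo_of_pairwise hP fun i j C hij hi hj => ?_⟩
    rw [hG.separated_iff]
    simpa using hI.iff_notLinkedIn_compl (H := G.lineGraph) hu (fun _ _ => Iff.rfl) hij hi hj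
  · rintro ⟨G, hG, h⟩
    rw [FaithfulTo] at h
    exact h ▸ hG.downwardStable
  -- The covariance graph: arcs record marginal dependence.
  · let G : MixedGraph V :=
      { Line := fun _ _ => False
        Arrow := fun _ _ => False
        Arc := fun i j => i ≠ j ∧ ¬ (probIndepModel P).Indep {i} {j} ∅
        line_symm := id
        arc_symm := fun {i j} h => ⟨h.1.symm, fun h' => h.2 (hI.symm h')⟩
        line_irrefl := fun _ => id
        arrow_irrefl := fun _ => id
        arc_irrefl := fun _ h => h.1 rfl }
    have hG : G.IsBidirected := fun _ _ => ⟨id, id⟩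
    refine ⟨G, hG, faithfulTo_of_pairwise hP fun i j C hij hi hj => ?_⟩
    rw [hG.separated_iff (by simpa) (by simpa)]
    simpa using hI.iff_notLinkedIn_union (H := G.arcGraph) hd (fun _ _ => Iff.rfl) hij hi hj
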